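/- Let $H$ be a complex Hilbert space, $d\in\mathbb N$, and let $\mathbf T=(T_1,\dots,T_d)$ be a $d$-tuple of bounded linear operators on $H$ (not assumed to commute). Let $P=(T_1^*T_1+\cdots+T_d^*T_d)^{1/2}$ and let $\mathbf T=(V_1P,\dots,V_dP)$ be the canonical spherical polar decomposition, i.e. $(V_1,\dots,V_d)$ is the unique $d$-tuple of bounded operators on $H$ such that $T_i=V_iP$ for all $i$ and $\sum_{i=1}^d V_i^*V_i$ is the orthogonal projection onto $\left(\bigcap_{i=1}^d\ker T_i\right)^\perp$. Define the spherical Aluthge transform $\widetilde{\mathbf T}=(P^{1/2}V_iP^{1/2})_{i=1}^d$, the spherical mean transform $\widehat{\mathbf T}=\left(\tfrac12(T_i+PV_i)\right)_{i=1}^d$, and, for $t\in[0,1]$, the spherical Heinz transform $$\widehat{\mathbf T}(t)=\left(\tfrac12\left(P^tV_iP^{1-t}+P^{1-t}V_iP^t\right)\right)_{i=1}^d\qquad(P^0=I).$$ For a $d$-tuple $\mathbf S=(S_1,\dots,S_d)$ of bounded operators on $H$, let $\|\mathbf S\|=\sup\left\{\left(\sum_{k=1}^d\|S_kx\|^2\right)^{1/2}: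 x\in H,\ \|x\|=1\right\}$ be the joint operator norm (with the value $0$ if $H=\{0\}$). Then, for every $t\in[0,1]$, with $r_0=\min\{t,1-t\}$, $$\|\widehat{\mathbf T}(t)\|\le 2r_0\|\widetilde{\mathbf T}\|+(1-2r_0)\|\widehat{\mathbf T}\|\le\|\widehat{\mathbf T}\|\le\|\mathbf T\|.$$ In particular, $\|\widetilde{\mathbf T}\|\le\|\widehat{\mathbf T}\|\le\|\mathbf T\|$. -/

import Mathlib

open scoped InnerProductSpace

noncomputable section

namespace SphericalTransform

section

variable {H : Type*} [NormedAddCommGroup H] [InnerProductSpace ℂ H] [CompleteSpace H] {d : ℕ}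

/-- The spherical (joint) operator norm
`‖T‖ = sup {(∑ₖ ‖Tₖ x‖²)^{1/2} : x ∈ H, ‖x‖ = 1}` of an operator `d`-tuple. -/
def jointNorm (T : Fin d → (H →L[ℂ] H)) : ℝ :=
  sSup {r : ℝ | ∃ x : H, ‖x‖ = 1 ∧ r = Real.sqrt (∑ k, ‖T k x‖ ^ 2)}

/-- The set in the definition of the joint norm is bounded above. -/
theorem bddAbove_jointNorm (T : Fin d → (H →L[ℂ] H)) :
    BddAbove {r : ℝ | ∃ x : H, ‖x‖ = 1 ∧ r = Real.sqrt (∑ k, ‖T k x‖ ^ 2)} := by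
  refine ⟨Real.sqrt (∑ k, ‖T k‖ ^ 2), ?_⟩
  rintro r ⟨x, hx, rfl⟩
  refine Real.sqrt_le_sqrt (Finset.sum_le_sum fun k _ => ?_)
  have := (T k).le_opNorm x
  rw [hx, mul_one] at this
  gcongr

/-- The joint modulus `P = (T₁* T₁ + ⋯ + T_d* T_d)^{1/2}` of an operator tuple. -/
def jointModulus (T : Fin d → (H →L[ℂ] H)) : H →L[ℂ] H :=
  CFC.sqrt (∑ k, star (T k) * T k)

/-- `V = (V₁, …, V_d)` is the partial isometry of the canonical spherical polar decomposition
of `T`: `Tᵢ = Vᵢ P` for all `i`, and `V₁* V₁ + ⋯ + V_d* V_d` is the orthogonal projection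
onto `(⋂ᵢ ker Tᵢ)ᗮ`. -/
structure IsPolarFactor (T V : Fin d → (H →L[ℂ] H)) : Prop where
  mul_jointModulus : ∀ i, V i * jointModulus T = T i
  sum_star_mul_self : ∑ i, star (V i) * V i = (⨅ i, (T i).ker)ᗮ.starProjection

theorem inner_sum_star_mul_self (T : Fin d → (H →L[ℂ] H)) (x : H) :
    ⟪(∑ i, star (T i) * T i) x, x⟫_ℂ = ((∑ i, ‖T i x‖ ^ 2 : ℝ) : ℂ) := by
  simp [sum_apply, ContinuousLinearMap.star_eq_adjoint,
    ContinuousLinearMap.adjoint_inner_left, inner_self_eq_norm_sq_to_K]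

theorem jointModulus_nonneg (T : Fin d → (H →L[ℂ] H)) : 0 ≤ jointModulus T :=
  CFC.sqrt_nonneg _

theorem jointModulus_mul_self (T : Fin d → (H →L[ℂ] H)) :
    jointModulus T * jointModulus T = ∑ k, star (T k) * T k :=
  CFC.sqrt_mul_sqrt_self _ (Finset.sum_nonneg fun k _ => star_mul_self_nonneg (T k))

theorem norm_jointModulus_sq (T : Fin d → (H →L[ℂ] H)) (x : H) :
    ‖jointModulus T x‖ ^ 2 = ∑ i, ‖T i x‖ ^ 2 := by
  have hsa : star (jointModulus T) = jointModulus T := (jointModulus_nonneg T).isSelfAdjoint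
  have h := inner_sum_star_mul_self T x
  rw [← jointModulus_mul_self] at h
  nth_rewrite 1 [← hsa] at h
  rw [mul_apply_eq_comp, ContinuousLinearMap.star_eq_adjoint,
    ContinuousLinearMap.adjoint_inner_left, inner_self_eq_norm_sq_to_K] at h
  simp only [Complex.coe_algebraMap] at h
  exact_mod_cast h

theorem ker_jointModulus (T : Fin d → (H →L[ℂ] H)) :
    (jointModulus T).ker = ⨅ i, (T i).ker := by
  ext x
  have h := norm_jointModulus_sq T x
  simp only [Submodule.mem_iInf, LinearMap.mem_ker, ContinuousLinearMap.coe_coe]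
  constructor
  · intro hx i
    rw [hx, norm_zero, zero_pow two_ne_zero, eq_comm,
      Finset.sum_eq_zero_iff_of_nonneg fun _ _ => sq_nonneg _] at h
    simpa using h i (Finset.mem_univ i)
  · intro hx
    simpa [hx] using h

theorem closure_range_jointModulus (T : Fin d → (H →L[ℂ] H)) :
    (jointModulus T).range.topologicalClosure = (⨅ i, (T i).ker)ᗮ := by
  rw [← ker_jointModulus, ContinuousLinearMap.orthogonal_ker,
    ← ContinuousLinearMap.star_eq_adjoint, (jointModulus_nonneg T).isSelfAdjoint.star_eq]

/-- Existence of the canonical spherical polar decomposition. -/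
theorem exists_isPolarFactor (T : Fin d → (H →L[ℂ] H)) : ∃ V, IsPolarFactor T V := by
  set P := jointModulus T with hP
  set K := P.range.topologicalClosure with hK
  have hKc : IsClosed (K : Set H) := Submodule.isClosed_topologicalClosure _
  have : CompleteSpace K := hKc.completeSpace_coe
  have hmem : ∀ x, P x ∈ K := fun x => Submodule.le_topologicalClosure _ ⟨x, rfl⟩
  let e : H →ₗ[ℂ] K := P.toLinearMap.codRestrict K hmem
  have he : ∀ x, ((e x : K) : H) = P x := fun x => rfl
  have hdense : DenseRange e := by
    intro y
    rw [closure_subtype]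
    have hy : (y : H) ∈ closure (P.range : Set H) := y.2
    convert hy using 2
    ext z
    constructor
    · rintro ⟨_, ⟨x, rfl⟩, rfl⟩; exact ⟨x, rfl⟩
    · rintro ⟨x, rfl⟩; exact ⟨e x, ⟨x, rfl⟩, rfl⟩
  have hle : ∀ i x, ‖(T i).toLinearMap x‖ ≤ 1 * ‖e x‖ := by
    intro i x
    rw [one_mul]
    refine le_of_sq_le_sq ?_ (norm_nonneg _)
    have : ‖e x‖ ^ 2 = ∑ i, ‖T i x‖ ^ 2 := norm_jointModulus_sq T x
    rw [this]
    exact Finset.single_le_sum (f := fun i => ‖T i x‖ ^ 2) (fun _ _ => sq_nonneg _)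
      (Finset.mem_univ i)
  let W : Fin d → (K →L[ℂ] H) := fun i => (T i).toLinearMap.extendOfNorm e
  have hW : ∀ i x, W i (e x) = T i x := fun i x =>
    LinearMap.extendOfNorm_eq hdense ⟨1, hle i⟩ x
  have hWn : ∀ y : K, ∑ i, ‖W i y‖ ^ 2 = ‖y‖ ^ 2 := by
    intro y
    refine hdense.induction_on (p := fun y : K => ∑ i, ‖W i y‖ ^ 2 = ‖y‖ ^ 2) y ?_ ?_
    · exact isClosed_eq (by fun_prop) (by fun_prop)
    · intro x
      simp only [hW]
      exact (norm_jointModulus_sq T x).symm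
  have hKo : K = (⨅ i, (T i).ker)ᗮ := closure_range_jointModulus T
  refine ⟨fun i => W i ∘L K.orthogonalProjectionOnto, ?_, ?_⟩
  · intro i
    ext x
    have : K.orthogonalProjectionOnto (P x) = e x :=
      Submodule.orthogonalProjectionOnto_mem_subspace_eq_self (e x)
    simp only [mul_apply_eq_comp, ContinuousLinearMap.comp_apply]
    rw [← hP, this, hW]
  · have key : ∑ i, star (W i ∘L K.orthogonalProjectionOnto) * (W i ∘L K.orthogonalProjectionOnto)
        = K.starProjection := by
      refine ContinuousLinearMap.coe_injective ((ext_inner_map _ _).1 fun x => ?_)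
      simp only [ContinuousLinearMap.coe_coe]
      rw [inner_sum_star_mul_self]
      simp only [ContinuousLinearMap.comp_apply, hWn]
      rw [← K.isIdempotentElem_starProjection.eq, mul_apply_eq_comp,
        K.inner_starProjection_left_eq_right, inner_self_eq_norm_sq_to_K]
      simp
    rw [key]
    congr 1

/-- The polar factor is unique. -/
theorem IsPolarFactor.unique {T V W : Fin d → (H →L[ℂ] H)} (hV : IsPolarFactor T V)
    (hW : IsPolarFactor T W) : V = W := by
  have hz : ∀ {V : Fin d → (H →L[ℂ] H)}, IsPolarFactor T V → ∀ x ∈ (⨅ i, (T i).ker)ᗮᗮ, ∀ i,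
      V i x = 0 := by
    intro V hV x hx i
    have h := inner_sum_star_mul_self V x
    rw [hV.sum_star_mul_self, (Submodule.starProjection_apply_eq_zero_iff _).2 hx,
      inner_zero_left, eq_comm, Complex.ofReal_eq_zero,
      Finset.sum_eq_zero_iff_of_nonneg fun _ _ => sq_nonneg _] at h
    simpa using h i (Finset.mem_univ i)
  funext i
  ext x
  set N := (⨅ i, (T i).ker)ᗮ with hN
  obtain ⟨y, hy, z, hz', rfl⟩ := N.exists_add_mem_mem_orthogonal x
  rw [map_add, map_add, hz hV z hz' i, hz hW z hz' i, add_zero, add_zero]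
  rw [hN, ← closure_range_jointModulus] at hy
  have hc : IsClosed {y : H | V i y = W i y} := isClosed_eq (by fun_prop) (by fun_prop)
  refine closure_minimal ?_ hc hy
  rintro _ ⟨u, rfl⟩
  have h1 := congrArg (fun A : H →L[ℂ] H => A u) (hV.mul_jointModulus i)
  have h2 := congrArg (fun A : H →L[ℂ] H => A u) (hW.mul_jointModulus i)
  exact h1.trans h2.symm

/-- The tuple `V = (V₁, …, V_d)` in the canonical spherical polar decomposition `T = V P`. -/
def polarFactor (T : Fin d → (H →L[ℂ] H)) : Fin d → (H →L[ℂ] H) :=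
  (exists_isPolarFactor T).choose

theorem isPolarFactor_polarFactor (T : Fin d → (H →L[ℂ] H)) : IsPolarFactor T (polarFactor T) :=
  (exists_isPolarFactor T).choose_spec

/-- The spherical Aluthge transform `(P^{1/2} Vᵢ P^{1/2})ᵢ`. -/
def aluthge (T : Fin d → (H →L[ℂ] H)) : Fin d → (H →L[ℂ] H) := fun i =>
  jointModulus T ^ (1 / 2 : ℝ) * polarFactor T i * jointModulus T ^ (1 / 2 : ℝ)

/-- The spherical Duggal transform `(P Vᵢ)ᵢ`. -/
def duggal (T : Fin d → (H →L[ℂ] H)) : Fin d → (H →L[ℂ] H) := fun i =>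
  jointModulus T * polarFactor T i

/-- The spherical mean transform `(T + Tᴰ) / 2`. -/
def meanTransform (T : Fin d → (H →L[ℂ] H)) : Fin d → (H →L[ℂ] H) :=
  (1 / 2 : ℂ) • (T + duggal T)

/-- The generalized spherical Aluthge transform `(P^t Vᵢ P^{1-t})ᵢ`, `0 ≤ t ≤ 1`
(with `P^0 = 1`). -/
def genAluthge (T : Fin d → (H →L[ℂ] H)) (t : ℝ) : Fin d → (H →L[ℂ] H) := fun i =>
  jointModulus T ^ t * polarFactor T i * jointModulus T ^ (1 - t)

/-- The spherical Heinz transform `(P^t Vᵢ P^{1-t} + P^{1-t} Vᵢ P^t)ᵢ / 2`, `0 ≤ t ≤ 1`. -/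
def heinz (T : Fin d → (H →L[ℂ] H)) (t : ℝ) : Fin d → (H →L[ℂ] H) :=
  (1 / 2 : ℂ) • (genAluthge T t + genAluthge T (1 - t))

end

end SphericalTransform

end

namespace SphericalTransform

open Real Filter Topology

/-- A bounded midpoint-convex function lies below its chord. -/
theorem le_chord_of_midpoint_convex {f : ℝ → ℝ} {M : ℝ}
    (hM : ∀ t ∈ Set.Icc (0 : ℝ) 1, f t ≤ M)
    (hf : ∀ s ∈ Set.Icc (0 : ℝ) 1, ∀ t ∈ Set.Icc (0 : ℝ) 1, f ((s + t) / 2) ≤ (f s + f t) / 2)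
    {t : ℝ} (ht : t ∈ Set.Icc (0 : ℝ) 1) : f t ≤ t * f 1 + (1 - t) * f 0 := by
  set g : ℝ → ℝ := fun t => f t - (t * f 1 + (1 - t) * f 0) with hg
  obtain ⟨N, hN0, hN⟩ : ∃ N : ℝ, 0 ≤ N ∧ ∀ t ∈ Set.Icc (0 : ℝ) 1, g t ≤ N := by
    refine ⟨|M| + |f 1| + |f 0|, by positivity, fun t ht => ?_⟩
    obtain ⟨h0, h1⟩ := ht
    have h2 := hM t ⟨h0, h1⟩
    have h3 : -(t * f 1) ≤ |f 1| := by
      have := neg_abs_le (f 1)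
      have := abs_nonneg (f 1)
      nlinarith
    have h4 : -((1 - t) * f 0) ≤ |f 0| := by
      have := neg_abs_le (f 0)
      have := abs_nonneg (f 0)
      nlinarith
    have := le_abs_self M
    simp only [hg]
    linarith
  have hstep : ∀ n : ℕ, ∀ t ∈ Set.Icc (0 : ℝ) 1, g t ≤ N * (1 / 2) ^ n := by
    intro n
    induction n with
    | zero => simpa using hN
    | succ n ih =>
      rintro t ⟨h0, h1⟩
      rcases le_total t (1 / 2) with h | h
      · have h2 := ih (2 * t) ⟨by linarith, by linarith⟩
        have h3 := hf 0 (by simp) (2 * t) ⟨by linarith, by linarith⟩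
        rw [show (0 + 2 * t) / 2 = t by ring] at h3
        simp only [hg, pow_succ] at h2 ⊢
        linarith
      · have h2 := ih (2 * t - 1) ⟨by linarith, by linarith⟩
        have h3 := hf 1 (by simp) (2 * t - 1) ⟨by linarith, by linarith⟩
        rw [show (1 + (2 * t - 1)) / 2 = t by ring] at h3
        simp only [hg, pow_succ] at h2 ⊢
        linarith
  have hlim : Tendsto (fun n : ℕ => N * (1 / 2 : ℝ) ^ n) atTop (𝓝 (N * 0)) :=
    (tendsto_pow_atTop_nhds_zero_of_lt_one (by norm_num) (by norm_num)).const_mul N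
  have := ge_of_tendsto' hlim fun n => hstep n t ht
  simp only [hg, mul_zero] at this
  linarith

section

variable {E F : Type*} [NormedAddCommGroup E] [InnerProductSpace ℂ E] [CompleteSpace E]
  [NormedAddCommGroup F] [InnerProductSpace ℂ F] [CompleteSpace F]

/-- The operator arithmetic-geometric mean inequality `2 ‖C X D‖ ≤ ‖C² X + X D²‖`. -/
theorem two_mul_norm_comp_comp_le {C : F →L[ℂ] F} {D : E →L[ℂ] E} (hC : IsSelfAdjoint C)
    (hD : IsSelfAdjoint D) (X : E →L[ℂ] F) :
    2 * ‖C ∘L X ∘L D‖ ≤ ‖C ∘L C ∘L X + X ∘L D ∘L D‖ := by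
  set S := C ∘L X ∘L D with hS
  set N := ‖C ∘L C ∘L X + X ∘L D ∘L D‖ with hN
  by_contra! hlt
  set m := ‖S‖ with hm
  have hN0 : 0 ≤ N := norm_nonneg _
  have hm0 : 0 < m := by linarith
  have hC' : ∀ x y, ⟪C x, y⟫_ℂ = ⟪x, C y⟫_ℂ := fun x y =>
    (ContinuousLinearMap.isSelfAdjoint_iff_isSymmetric.1 hC) x y
  have hD' : ∀ x y, ⟪D x, y⟫_ℂ = ⟪x, D y⟫_ℂ := fun x y =>
    (ContinuousLinearMap.isSelfAdjoint_iff_isSymmetric.1 hD) x y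
  have hadj : ∀ v, D (X.adjoint (C v)) = S.adjoint v := by
    intro v
    refine ext_inner_right ℂ fun w => ?_
    rw [hD', ContinuousLinearMap.adjoint_inner_left, ContinuousLinearMap.adjoint_inner_left, hC']
    rfl
  have hre : ∀ (r : ℝ) (z : ℂ), RCLike.re ((r : ℂ) * z) = r * RCLike.re z := Complex.re_ofReal_mul
  have key : ∀ u : E, ‖u‖ ≤ 1 → 0 < ‖S u‖ →
      (2 * m - N) * ‖S u‖ ^ 2 ≤ ‖X ∘L D‖ * ‖D‖ * √(m ^ 4 - m ^ 2 * ‖S u‖ ^ 2) := by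
    intro u hu hSu
    set q := X (D u) with hq
    set p := X.adjoint (C (S u)) with hp
    set e := S.adjoint (S u) - ((m ^ 2 : ℝ) : ℂ) • u with he
    have hCq : C q = S u := rfl
    have hDp : D p = ((m ^ 2 : ℝ) : ℂ) • u + e := by rw [hp, hadj, he]; abel
    have hq0 : 0 < ‖q‖ := by
      rw [norm_pos_iff]
      intro h
      rw [← hCq, h, map_zero, norm_zero] at hSu
      exact lt_irrefl _ hSu
    have hinner : RCLike.re ⟪S.adjoint (S u), u⟫_ℂ = ‖S u‖ ^ 2 := by
      rw [ContinuousLinearMap.adjoint_inner_left, inner_self_eq_norm_sq]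
    have hSS : ‖S.adjoint (S u)‖ ≤ m * ‖S u‖ := by
      have := S.adjoint.le_opNorm (S u)
      rwa [LinearIsometryEquiv.norm_map] at this
    have he2 : ‖e‖ ≤ √(m ^ 4 - m ^ 2 * ‖S u‖ ^ 2) := by
      refine Real.le_sqrt_of_sq_le ?_
      rw [he, @norm_sub_sq ℂ, inner_smul_right, norm_smul, hre, hinner,
        Complex.norm_real, Real.norm_eq_abs, abs_of_nonneg (sq_nonneg m)]
      have h1 : ‖S.adjoint (S u)‖ ^ 2 ≤ m ^ 2 * ‖S u‖ ^ 2 := by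
        rw [← mul_pow]; gcongr
      have h2 : (m ^ 2 * ‖u‖) ^ 2 ≤ m ^ 4 := by
        have : (m ^ 2 * ‖u‖) ^ 2 ≤ (m ^ 2 * 1) ^ 2 := by gcongr
        linarith
      linarith
    have hpq : RCLike.re ⟪(C ∘L C ∘L X + X ∘L D ∘L D) p, q⟫_ℂ
        = ‖p‖ ^ 2 + m ^ 2 * ‖q‖ ^ 2 + RCLike.re ⟪(X ∘L D) e, q⟫_ℂ := by
      simp only [add_apply, ContinuousLinearMap.comp_apply, inner_add_left, map_add]
      rw [hC', hC', hCq, ← ContinuousLinearMap.adjoint_inner_right, ← hp, hDp]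
      simp only [map_add, map_smul, inner_add_left, inner_smul_left, ← hq]
      rw [inner_self_eq_norm_sq, Complex.conj_ofReal, hre, inner_self_eq_norm_sq]
      ring
    have hle : RCLike.re ⟪(C ∘L C ∘L X + X ∘L D ∘L D) p, q⟫_ℂ ≤ N * ‖p‖ * ‖q‖ :=
      (re_inner_le_norm _ _).trans
        (mul_le_mul_of_nonneg_right (ContinuousLinearMap.le_opNorm _ _) (norm_nonneg _))
    have hge : -(‖X ∘L D‖ * ‖e‖ * ‖q‖) ≤ RCLike.re ⟪(X ∘L D) e, q⟫_ℂ := by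
      have h1 : |RCLike.re ⟪(X ∘L D) e, q⟫_ℂ| ≤ ‖(X ∘L D) e‖ * ‖q‖ :=
        (RCLike.abs_re_le_norm _).trans (norm_inner_le_norm _ _)
      have h2 : ‖(X ∘L D) e‖ * ‖q‖ ≤ ‖X ∘L D‖ * ‖e‖ * ‖q‖ :=
        mul_le_mul_of_nonneg_right (ContinuousLinearMap.le_opNorm _ _) (norm_nonneg _)
      exact (neg_le_neg (h1.trans h2)).trans (neg_abs_le _)
    have hp1 : (2 * m - N) * ‖p‖ ≤ ‖X ∘L D‖ * ‖e‖ := by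
      refine le_of_mul_le_mul_right ?_ hq0
      nlinarith [sq_nonneg (‖p‖ - m * ‖q‖)]
    have hp2 : ‖S u‖ ^ 2 ≤ ‖D‖ * ‖p‖ := by
      rw [← hinner]
      calc _ ≤ ‖S.adjoint (S u)‖ * ‖u‖ := re_inner_le_norm _ _
        _ ≤ ‖S.adjoint (S u)‖ * 1 := by gcongr
        _ = ‖D p‖ := by rw [mul_one, hp, hadj]
        _ ≤ _ := D.le_opNorm p
    calc (2 * m - N) * ‖S u‖ ^ 2 ≤ (2 * m - N) * (‖D‖ * ‖p‖) :=
          mul_le_mul_of_nonneg_left hp2 (by linarith)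
      _ = ‖D‖ * ((2 * m - N) * ‖p‖) := by ring
      _ ≤ ‖D‖ * (‖X ∘L D‖ * ‖e‖) := by gcongr
      _ = ‖X ∘L D‖ * ‖D‖ * ‖e‖ := by ring
      _ ≤ _ := by gcongr
  have hlim : ∀ r ∈ Set.Ioo 0 m,
      (2 * m - N) * r ^ 2 ≤ ‖X ∘L D‖ * ‖D‖ * √(m ^ 4 - m ^ 2 * r ^ 2) := by
    rintro r ⟨hr0, hrm⟩
    obtain ⟨u, hu, hru⟩ := S.exists_lt_apply_of_lt_opNorm hrm
    refine le_trans ?_ ((key u hu.le (hr0.trans hru)).trans ?_)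
    · have : 0 ≤ 2 * m - N := by linarith
      gcongr
    · gcongr
  have hcont : ContinuousWithinAt (fun r : ℝ => (2 * m - N) * r ^ 2) (Set.Ioo 0 m) m :=
    Continuous.continuousWithinAt (by fun_prop)
  have hcont' : ContinuousWithinAt
      (fun r : ℝ => ‖X ∘L D‖ * ‖D‖ * √(m ^ 4 - m ^ 2 * r ^ 2)) (Set.Ioo 0 m) m :=
    Continuous.continuousWithinAt (by fun_prop)
  have hmem : m ∈ closure (Set.Ioo 0 m) := by
    rw [closure_Ioo hm0.ne]
    exact ⟨hm0.le, le_rfl⟩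
  have := ContinuousWithinAt.closure_le hmem hcont hcont' hlim
  rw [show m ^ 4 - m ^ 2 * m ^ 2 = 0 by ring, Real.sqrt_zero, mul_zero] at this
  have : 0 < (2 * m - N) * m ^ 2 := mul_pos (by linarith) (by positivity)
  linarith

end

section

variable {E H : Type*} [NormedAddCommGroup E] [InnerProductSpace ℂ E]
  [NormedAddCommGroup H] [InnerProductSpace ℂ H] {d : ℕ}

/-- The Hilbert space direct sum of `d` copies of `H`. -/
def DirectSumPower (d : ℕ) (H : Type*) : Type _ := PiLp 2 (fun _ : Fin d => H)

noncomputable instance : NormedAddCommGroup (DirectSumPower d H) :=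
  inferInstanceAs (NormedAddCommGroup (PiLp 2 fun _ : Fin d => H))

noncomputable instance : InnerProductSpace ℂ (DirectSumPower d H) :=
  inferInstanceAs (InnerProductSpace ℂ (PiLp 2 fun _ : Fin d => H))

instance [CompleteSpace H] : CompleteSpace (DirectSumPower d H) :=
  inferInstanceAs (CompleteSpace (PiLp 2 fun _ : Fin d => H))

/-- The coordinates of a vector of `DirectSumPower d H`. -/
def DirectSumPower.coord (x : DirectSumPower d H) (i : Fin d) : H := WithLp.ofLp x i

theorem DirectSumPower.norm_sq_eq (x : DirectSumPower d H) : ‖x‖ ^ 2 = ∑ i, ‖x.coord i‖ ^ 2 :=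
  PiLp.norm_sq_eq_of_L2 _ _

theorem DirectSumPower.inner_eq (x y : DirectSumPower d H) :
    ⟪x, y⟫_ℂ = ∑ i, ⟪x.coord i, y.coord i⟫_ℂ :=
  PiLp.inner_apply _ _

/-- The column operator `x ↦ (T₁ x, …, T_d x)` of an operator tuple. -/
noncomputable def column (T : Fin d → (E →L[ℂ] H)) : E →L[ℂ] DirectSumPower d H :=
  (PiLp.continuousLinearEquiv 2 ℂ (fun _ : Fin d => H)).symm.toContinuousLinearMap ∘L
    ContinuousLinearMap.pi T

/-- The diagonal operator `(x₁, …, x_d) ↦ (A x₁, …, A x_d)`. -/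
noncomputable def diagonal (d : ℕ) (A : H →L[ℂ] H) :
    DirectSumPower d H →L[ℂ] DirectSumPower d H :=
  column fun i => A ∘L (PiLp.proj 2 (fun _ : Fin d => H) i : (PiLp 2 fun _ : Fin d => H) →L[ℂ] H)

@[simp]
theorem diagonal_apply (A : H →L[ℂ] H) (x : DirectSumPower d H) (i : Fin d) :
    (diagonal d A x).coord i = A (x.coord i) := rfl

theorem norm_column_apply_sq (T : Fin d → (E →L[ℂ] H)) (x : E) :
    ‖column T x‖ ^ 2 = ∑ i, ‖T i x‖ ^ 2 :=
  DirectSumPower.norm_sq_eq _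

theorem norm_diagonal_le (A : H →L[ℂ] H) : ‖diagonal d A‖ ≤ ‖A‖ := by
  refine ContinuousLinearMap.opNorm_le_bound _ (norm_nonneg _) fun x => ?_
  refine le_of_sq_le_sq ?_ (by positivity)
  rw [diagonal, norm_column_apply_sq, mul_pow, DirectSumPower.norm_sq_eq, Finset.mul_sum]
  refine Finset.sum_le_sum fun i _ => ?_
  rw [← mul_pow]
  gcongr
  exact A.le_opNorm _

theorem isSelfAdjoint_diagonal [CompleteSpace H] {A : H →L[ℂ] H} (hA : IsSelfAdjoint A) :
    IsSelfAdjoint (diagonal d A) := by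
  rw [ContinuousLinearMap.isSelfAdjoint_iff_isSymmetric] at hA ⊢
  intro x y
  simp only [ContinuousLinearMap.coe_coe, DirectSumPower.inner_eq, diagonal_apply]
  exact Finset.sum_congr rfl fun i _ => hA _ _

theorem column_add (S T : Fin d → (E →L[ℂ] H)) : column (S + T) = column S + column T := rfl

theorem column_smul (c : ℂ) (T : Fin d → (E →L[ℂ] H)) : column (c • T) = c • column T := rfl

end

section

variable {H : Type*} [NormedAddCommGroup H] [InnerProductSpace ℂ H] [CompleteSpace H] {d : ℕ}

theorem jointNorm_eq_norm_column (T : Fin d → (H →L[ℂ] H)) : jointNorm T = ‖column T‖ := by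
  have hset : {r : ℝ | ∃ x : H, ‖x‖ = 1 ∧ r = √(∑ k, ‖T k x‖ ^ 2)}
      = (fun x => ‖column T x‖) '' Metric.sphere 0 1 := by
    ext r
    simp only [Set.mem_ofPred_eq, Set.mem_image, mem_sphere_zero_iff_norm, ← norm_column_apply_sq,
      Real.sqrt_sq (norm_nonneg _), eq_comm (a := r)]
  rw [jointNorm, hset]
  rcases subsingleton_or_nontrivial H with h | h
  · rw [Metric.sphere_eq_empty_of_subsingleton one_ne_zero, Set.image_empty, Real.sSup_empty,
      Subsingleton.elim (column T) 0, norm_zero]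
  · exact (column T).sSup_sphere_eq_norm

theorem jointNorm_nonneg (T : Fin d → (H →L[ℂ] H)) : 0 ≤ jointNorm T := by
  rw [jointNorm_eq_norm_column]
  exact norm_nonneg _

theorem jointNorm_add_le (S T : Fin d → (H →L[ℂ] H)) :
    jointNorm (S + T) ≤ jointNorm S + jointNorm T := by
  simp only [jointNorm_eq_norm_column, column_add]
  exact norm_add_le _ _

theorem jointNorm_smul (c : ℂ) (T : Fin d → (H →L[ℂ] H)) :
    jointNorm (c • T) = ‖c‖ * jointNorm T := by
  simp only [jointNorm_eq_norm_column, column_smul]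
  exact norm_smul _ _

theorem jointNorm_mul_mul_le (A B : H →L[ℂ] H) (T : Fin d → (H →L[ℂ] H)) :
    jointNorm (fun i => A * T i * B) ≤ ‖A‖ * jointNorm T * ‖B‖ := by
  simp only [jointNorm_eq_norm_column]
  calc ‖column fun i => A * T i * B‖ = ‖diagonal d A ∘L column T ∘L B‖ := rfl
    _ ≤ ‖diagonal d A‖ * (‖column T‖ * ‖B‖) :=
      (ContinuousLinearMap.opNorm_comp_le _ _).trans
        (mul_le_mul_of_nonneg_left (ContinuousLinearMap.opNorm_comp_le _ _) (norm_nonneg _))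
    _ ≤ ‖A‖ * (‖column T‖ * ‖B‖) := by gcongr; exact norm_diagonal_le A
    _ = _ := (mul_assoc _ _ _).symm

/-- The arithmetic-geometric mean inequality for the joint operator norm. -/
theorem two_mul_jointNorm_mul_mul_le {A B : H →L[ℂ] H} (hA : IsSelfAdjoint A)
    (hB : IsSelfAdjoint B) (T : Fin d → (H →L[ℂ] H)) :
    2 * jointNorm (fun i => A * T i * B) ≤ jointNorm fun i => A * A * T i + T i * (B * B) := by
  simp only [jointNorm_eq_norm_column]
  exact two_mul_norm_comp_comp_le (isSelfAdjoint_diagonal hA) hB (column T)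

theorem rpow_add_of_nonneg {P : H →L[ℂ] H} (_hP : 0 ≤ P) {s t : ℝ} (hs : 0 ≤ s) (ht : 0 ≤ t) :
    P ^ (s + t) = P ^ s * P ^ t := by
  have hc : ∀ {r : ℝ}, 0 ≤ r → ContinuousOn (fun x : NNReal => x ^ r) (spectrum NNReal P) :=
    fun hr => (NNReal.continuous_rpow_const hr).continuousOn
  simp only [CFC.rpow_def]
  rw [← cfc_mul _ _ P (hc hs) (hc ht)]
  congr 1
  funext x
  exact NNReal.rpow_add_of_nonneg x hs ht

theorem norm_rpow_le {P : H →L[ℂ] H} (hP : 0 ≤ P) {t : ℝ} (ht : t ∈ Set.Icc (0 : ℝ) 1) :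
    ‖P ^ t‖ ≤ 1 + ‖P‖ := by
  rcases ht.1.eq_or_lt with rfl | h0
  · rw [CFC.rpow_zero P]
    have : ‖(1 : H →L[ℂ] H)‖ ≤ 1 := ContinuousLinearMap.norm_id_le
    linarith [norm_nonneg P]
  · rw [CFC.norm_rpow P h0]
    calc ‖P‖ ^ t ≤ (1 + ‖P‖) ^ t := by
          gcongr
          linarith
      _ ≤ (1 + ‖P‖) ^ (1 : ℝ) :=
        Real.rpow_le_rpow_of_exponent_le (by linarith [norm_nonneg P]) ht.2
      _ = _ := Real.rpow_one _

theorem isSelfAdjoint_rpow (P : H →L[ℂ] H) (t : ℝ) : IsSelfAdjoint (P ^ t) :=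
  CFC.rpow_nonneg.isSelfAdjoint

variable (T : Fin d → (H →L[ℂ] H))

theorem heinz_one_sub (t : ℝ) : heinz T (1 - t) = heinz T t := by
  rw [heinz, heinz, sub_sub_cancel, add_comm]

theorem heinz_zero : heinz T 0 = meanTransform T := by
  have h := jointModulus_nonneg T
  rw [heinz, meanTransform, sub_zero]
  congr 2
  · funext i
    rw [genAluthge, sub_zero, CFC.rpow_zero _, CFC.rpow_one _, one_mul,
      (isPolarFactor_polarFactor T).mul_jointModulus]
  · funext i
    rw [genAluthge, sub_self, CFC.rpow_zero _, CFC.rpow_one _, mul_one, duggal]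

theorem heinz_half : heinz T (1 / 2) = aluthge T := by
  have h : genAluthge T (1 / 2) = aluthge T := by
    funext i
    rw [genAluthge, aluthge, show (1 - 1 / 2 : ℝ) = 1 / 2 by norm_num]
  rw [heinz, show (1 - 1 / 2 : ℝ) = 1 / 2 by norm_num, h, ← two_smul ℂ, smul_smul]
  norm_num

theorem jointNorm_genAluthge_le {t : ℝ} (ht : t ∈ Set.Icc (0 : ℝ) 1) :
    jointNorm (genAluthge T t)
      ≤ (1 + ‖jointModulus T‖) * jointNorm (polarFactor T) * (1 + ‖jointModulus T‖) := by
  have h1 := norm_rpow_le (jointModulus_nonneg T) ht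
  have h2 := norm_rpow_le (jointModulus_nonneg T) (t := 1 - t)
    ⟨by linarith [ht.2], by linarith [ht.1]⟩
  have h3 := jointNorm_nonneg (polarFactor T)
  refine (jointNorm_mul_mul_le _ _ _).trans ?_
  gcongr

theorem jointNorm_heinz_eq (t : ℝ) :
    jointNorm (heinz T t) = 1 / 2 * jointNorm (genAluthge T t + genAluthge T (1 - t)) := by
  rw [heinz, jointNorm_smul]
  norm_num

theorem jointNorm_heinz_le {t : ℝ} (ht : t ∈ Set.Icc (0 : ℝ) 1) :
    jointNorm (heinz T t)
      ≤ (1 + ‖jointModulus T‖) * jointNorm (polarFactor T) * (1 + ‖jointModulus T‖) := by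
  have h1 := jointNorm_genAluthge_le T ht
  have h2 := jointNorm_genAluthge_le T (t := 1 - t) ⟨by linarith [ht.2], by linarith [ht.1]⟩
  have h3 := jointNorm_add_le (genAluthge T t) (genAluthge T (1 - t))
  rw [jointNorm_heinz_eq]
  linarith

/-- Midpoint convexity of the norm of the spherical Heinz transform. -/
theorem jointNorm_heinz_le_of_add_sub {c r : ℝ} (hr : 0 ≤ r) (hcr : 0 ≤ c - r)
    (hcr' : 0 ≤ 1 - c - r) :
    jointNorm (heinz T c) ≤ (jointNorm (heinz T (c - r)) + jointNorm (heinz T (c + r))) / 2 := by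
  set P := jointModulus T with hP
  set V := polarFactor T with hV
  have hadd : ∀ {s t : ℝ}, 0 ≤ s → 0 ≤ t → P ^ s * P ^ t = P ^ (s + t) := fun hs ht =>
    (rpow_add_of_nonneg (jointModulus_nonneg T) hs ht).symm
  set Y : Fin d → (H →L[ℂ] H) := fun i =>
    P ^ (c - r) * V i * P ^ (1 - c - r) + P ^ (1 - c - r) * V i * P ^ (c - r) with hY
  have h := two_mul_jointNorm_mul_mul_le (isSelfAdjoint_rpow P r) (isSelfAdjoint_rpow P r) Y
  have h1 : (fun i => P ^ r * Y i * P ^ r) = genAluthge T c + genAluthge T (1 - c) := by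
    funext i
    simp only [hY, Pi.add_apply, genAluthge, ← hP, ← hV, mul_add, add_mul]
    congr 1
    · rw [mul_assoc, mul_assoc, hadd hcr' hr, ← mul_assoc, ← mul_assoc, hadd hr hcr]
      ring_nf
    · rw [mul_assoc, mul_assoc, hadd hcr hr, ← mul_assoc, ← mul_assoc, hadd hr hcr']
      ring_nf
  have h2 : (fun i => P ^ r * P ^ r * Y i + Y i * (P ^ r * P ^ r))
      = (genAluthge T (c - r) + genAluthge T (1 - (c - r)))
        + (genAluthge T (c + r) + genAluthge T (1 - (c + r))) := by
    funext i
    simp only [hY, Pi.add_apply, genAluthge, ← hP, ← hV, mul_add, add_mul, hadd hr hr]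
    simp only [mul_assoc, hadd hcr' (add_nonneg hr hr), hadd hcr (add_nonneg hr hr)]
    simp only [← mul_assoc, hadd (add_nonneg hr hr) hcr', hadd (add_nonneg hr hr) hcr]
    rw [show r + r + (c - r) = c + r by ring, show r + r + (1 - c - r) = 1 - (c - r) by ring,
      show 1 - c - r + (r + r) = 1 - (c - r) by ring, show c - r + (r + r) = c + r by ring,
      show 1 - c - r = 1 - (c + r) by ring, sub_sub_cancel, sub_sub_cancel]
    abel
  rw [h1, h2] at h
  have h3 := h.trans (jointNorm_add_le _ _)
  simp only [jointNorm_heinz_eq]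
  linarith

theorem jointNorm_heinz_midpoint {s t : ℝ} (hs : s ∈ Set.Icc (0 : ℝ) 1)
    (ht : t ∈ Set.Icc (0 : ℝ) 1) :
    jointNorm (heinz T ((s + t) / 2)) ≤ (jointNorm (heinz T s) + jointNorm (heinz T t)) / 2 := by
  wlog hst : s ≤ t generalizing s t
  · have := this ht hs (le_of_not_ge hst)
    rwa [add_comm t, add_comm (jointNorm (heinz T t))] at this
  have h := jointNorm_heinz_le_of_add_sub T (c := (s + t) / 2) (r := (t - s) / 2)
    (by linarith) (by linarith [hs.1]) (by linarith [ht.2])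
  rwa [show (s + t) / 2 - (t - s) / 2 = s by ring, show (s + t) / 2 + (t - s) / 2 = t by ring] at h

theorem jointNorm_heinz_le_chord {t : ℝ} (h0 : 0 ≤ t) (h1 : t ≤ 1 / 2) :
    jointNorm (heinz T t)
      ≤ 2 * t * jointNorm (aluthge T) + (1 - 2 * t) * jointNorm (meanTransform T) := by
  have hmem : ∀ s ∈ Set.Icc (0 : ℝ) 1, s / 2 ∈ Set.Icc (0 : ℝ) 1 := fun s hs =>
    ⟨by linarith [hs.1], by linarith [hs.2]⟩
  have h := le_chord_of_midpoint_convex (f := fun s => jointNorm (heinz T (s / 2)))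
    (fun s hs => jointNorm_heinz_le T (hmem s hs))
    (fun s hs t ht => by
      have := jointNorm_heinz_midpoint T (hmem s hs) (hmem t ht)
      rwa [← add_div] at this)
    (t := 2 * t) ⟨by linarith, by linarith⟩
  simpa only [mul_div_cancel_left₀ t (two_ne_zero' ℝ), zero_div, heinz_zero, heinz_half] using h

theorem jointNorm_aluthge_le_meanTransform :
    jointNorm (aluthge T) ≤ jointNorm (meanTransform T) := by
  have h := jointNorm_heinz_midpoint T (s := 0) (t := 1) (by simp) (by simp)
  have h1 : heinz T 1 = meanTransform T := by
    rw [← heinz_one_sub, sub_self, heinz_zero]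
  rw [zero_add, heinz_half, heinz_zero, h1] at h
  linarith

theorem jointNorm_eq_norm_jointModulus : jointNorm T = ‖jointModulus T‖ := by
  have h : ∀ x, ‖column T x‖ = ‖jointModulus T x‖ := fun x => by
    rw [← sq_eq_sq₀ (norm_nonneg _) (norm_nonneg _), norm_column_apply_sq, norm_jointModulus_sq]
  rw [jointNorm_eq_norm_column]
  exact le_antisymm
    (ContinuousLinearMap.opNorm_le_bound _ (norm_nonneg _) fun x =>
      (h x).trans_le ((jointModulus T).le_opNorm x))
    (ContinuousLinearMap.opNorm_le_bound _ (norm_nonneg _) fun x =>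
      (h x).symm.trans_le ((column T).le_opNorm x))

theorem jointNorm_polarFactor_le_one : jointNorm (polarFactor T) ≤ 1 := by
  rw [jointNorm_eq_norm_column]
  refine ContinuousLinearMap.opNorm_le_bound _ zero_le_one fun x => ?_
  set N := (⨅ i, (T i).ker)ᗮ
  have h := inner_sum_star_mul_self (polarFactor T) x
  rw [(isPolarFactor_polarFactor T).sum_star_mul_self, ← norm_column_apply_sq] at h
  have h1 : ‖column (polarFactor T) x‖ ^ 2 ≤ ‖x‖ * ‖x‖ := by
    calc ‖column (polarFactor T) x‖ ^ 2 = ‖⟪N.starProjection x, x⟫_ℂ‖ := by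
          rw [h, Complex.norm_real, Real.norm_of_nonneg (sq_nonneg _)]
      _ ≤ ‖N.starProjection x‖ * ‖x‖ := norm_inner_le_norm _ _
      _ ≤ ‖x‖ * ‖x‖ := by gcongr; exact N.norm_starProjection_apply_le x
  rw [one_mul]
  exact le_of_sq_le_sq (h1.trans_eq (sq _).symm) (norm_nonneg _)

theorem jointNorm_duggal_le : jointNorm (duggal T) ≤ jointNorm T := by
  have h := jointNorm_mul_mul_le (jointModulus T) 1 (polarFactor T)
  have h1 : ‖(1 : H →L[ℂ] H)‖ ≤ 1 := ContinuousLinearMap.norm_id_le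
  simp only [mul_one] at h
  calc jointNorm (duggal T) ≤ ‖jointModulus T‖ * jointNorm (polarFactor T) * ‖(1 : H →L[ℂ] H)‖ := h
    _ ≤ ‖jointModulus T‖ * 1 * 1 := by
      gcongr
      exact jointNorm_polarFactor_le_one T
    _ = jointNorm T := by rw [jointNorm_eq_norm_jointModulus]; ring

theorem jointNorm_meanTransform_le : jointNorm (meanTransform T) ≤ jointNorm T := by
  have h1 := jointNorm_add_le T (duggal T)
  have h2 := jointNorm_duggal_le T
  rw [meanTransform, jointNorm_smul]
  norm_num
  linarith

end

end SphericalTransform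

theorem theorem2p1 {H : Type*} [NormedAddCommGroup H] [InnerProductSpace ℂ H] [CompleteSpace H]
    {d : ℕ} (T : Fin d → (H →L[ℂ] H)) :
    (∀ t ∈ Set.Icc (0 : ℝ) 1,
      SphericalTransform.jointNorm (SphericalTransform.heinz T t) ≤
          2 * min t (1 - t) * SphericalTransform.jointNorm (SphericalTransform.aluthge T)
            + (1 - 2 * min t (1 - t)) *
              SphericalTransform.jointNorm (SphericalTransform.meanTransform T) ∧
      2 * min t (1 - t) * SphericalTransform.jointNorm (SphericalTransform.aluthge T)
            + (1 - 2 * min t (1 - t)) *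
              SphericalTransform.jointNorm (SphericalTransform.meanTransform T) ≤
          SphericalTransform.jointNorm (SphericalTransform.meanTransform T) ∧
      SphericalTransform.jointNorm (SphericalTransform.meanTransform T) ≤
          SphericalTransform.jointNorm T) ∧
    SphericalTransform.jointNorm (SphericalTransform.aluthge T) ≤
        SphericalTransform.jointNorm (SphericalTransform.meanTransform T) ∧
    SphericalTransform.jointNorm (SphericalTransform.meanTransform T) ≤
        SphericalTransform.jointNorm T := by
  refine ⟨fun t ht => ⟨?_, ?_, SphericalTransform.jointNorm_meanTransform_le T⟩,
    SphericalTransform.jointNorm_aluthge_le_meanTransform T,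
    SphericalTransform.jointNorm_meanTransform_le T⟩
  · rcases le_total t (1 - t) with h | h
    · rw [min_eq_left h]
      exact SphericalTransform.jointNorm_heinz_le_chord T ht.1 (by linarith)
    · rw [min_eq_right h, ← SphericalTransform.heinz_one_sub]
      exact SphericalTransform.jointNorm_heinz_le_chord T (by linarith [ht.2]) (by linarith)
  · have h1 := SphericalTransform.jointNorm_aluthge_le_meanTransform T
    have h2 : 0 ≤ min t (1 - t) := le_min ht.1 (by linarith [ht.2])
    nlinarith
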